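/- Let $(R,\mathfrak m)$ be a commutative Noetherian local ring and $I$ an ideal of $R$. A Serre subcategory of the category $R\text{-}\mathrm{Mod}$ of all $R$-modules is a full subcategory that contains $0$ and is closed under submodules, quotient modules and extensions. Let $\mathcal S_1,\mathcal S_2$ be Serre subcategories of $R\text{-}\mathrm{Mod}$, each containing a nonzero module, and let $(\mathcal S_1,\mathcal S_2)$ be the class of all $R$-modules $M$ for which there is a short exact sequence $0\to A\to M\to B\to 0$ with $A\in\mathcal S_1$ and $B\in\mathcal S_2$. For an $R$-module $M$ write $\Gamma_I(M)=\{x\in M : I^n x=0 \text{ for some } n\ge 0\}$ and $(0:_M I)=\{x\in M : Ix=0\}$. Suppose that $(\mathcal S_1,\mathcal S_2)$ satisfies the condition $(C_I)$: for every $R$-module $M$ with $M=\Gamma_I(M)$ and $(0:_M I)\in(\mathcal S_1,\mathcal S_2)$, one has $M\in(\mathcal S_1,\mathcal S_2)$. Then for every finitely generated $R$-module $M$ the local cohomology module $H_I^{\dim M}(M)$ belongs to $(\mathcal S_1,\mathcal S_2)$. Here $H_I^i(M)=\varinjlim_t \mathrm{Ext}_R^i(R/I^t,M)$ and $\dim M$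 is the Krull dimension of the support of $M$; for $M=0$ the assertion is that $H^i_I(M)\in(\mathcal S_1,\mathcal S_2)$ for every $i\ge 0$. -/

import Mathlib

open CategoryTheory

universe u

/-- The `I`-torsion submodule `Γ_I(M)`: all elements annihilated by some power of `I`. -/
def gammaTorsion {R : Type u} [CommRing R] (I : Ideal R) (M : Type u) [AddCommGroup M]
    [Module R M] : Submodule R M where
  carrier := {x | ∃ n : ℕ, ∀ a ∈ I ^ n, a • x = 0}
  zero_mem' := ⟨0, fun a _ => smul_zero a⟩
  add_mem' := by
    rintro x y ⟨m, hm⟩ ⟨n, hn⟩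
    refine ⟨m + n, fun a ha => ?_⟩
    rw [smul_add, hm a (Ideal.pow_le_pow_right (Nat.le_add_right m n) ha),
      hn a (Ideal.pow_le_pow_right (Nat.le_add_left n m) ha), add_zero]
  smul_mem' := by
    rintro c x ⟨n, hn⟩
    exact ⟨n, fun a ha => by rw [smul_comm, hn a ha, smul_zero]⟩

/-- The class `(S₁, S₂)` of all modules `M` that fit into a short exact sequence
`0 → A → M → B → 0` with `A` in `S₁` and `B` in `S₂`. -/
def extensionClass {R : Type u} [CommRing R] (S₁ S₂ : ObjectProperty (ModuleCat.{u} R)) :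
    ObjectProperty (ModuleCat.{u} R) :=
  fun M => ∃ (A B : ModuleCat.{u} R) (f : A ⟶ M) (g : M ⟶ B) (w : f ≫ g = 0),
    S₁ A ∧ S₂ B ∧ (ShortComplex.mk f g w).ShortExact

/-- The condition `(C_I)` on a class `X` of modules: if `M = Γ_I(M)` and the submodule
`(0 :_M I)` of elements annihilated by `I` is in `X`, then `M` is in `X`. -/
def ConditionC {R : Type u} [CommRing R] (I : Ideal R) (X : ObjectProperty (ModuleCat.{u} R)) :
    Prop :=
  ∀ M : ModuleCat.{u} R, gammaTorsion I M = ⊤ →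
    X (ModuleCat.of R (Submodule.torsionBySet R M (I : Set R))) → X M

/-! The assertion is proved for every `d` with `dim M ≤ d`, by induction on `d`. For `d = 0` the
module has support in `{𝔪}`; a nonzero Serre class contains the residue field, hence `M`, hence
`H⁰(M) ⊆ M`, so `H⁰(M)` lies in `S₁`.

For `d + 1`, positive local cohomology of `Γ_I(M)` vanishes, so `H^(d+1)(M)` embeds into
`H^(d+1)(N)` with `N = M/Γ_I(M)`. Prime avoidance gives an `N`-regular `x ∈ I`. Elements of
`H^(d+1)(N)` killed by `I` are killed by `x`, hence lie in the image of `H^d(N/xN)`, where `dim N/xN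
≤ d`. The class `(S₁, S₂)` is closed under submodules and quotients, so it contains `(0 : I)`, and
`(C_I)` yields `H^(d+1)(N)`.

The vanishing for `I`-power torsion modules comes from Artin–Rees
(`exists_mk₀_subtype_comp_eq_zero`). Exact sequences are used on `Ext` at finite stages of the
direct limit; `extLimitEquiv` identifies that limit with `localCohomology`. -/

section

open Limits Abelian Opposite Pointwise

variable {R : Type u} [CommRing R]

/-! ### Comparison of the two versions of `Ext`, through projective resolutions. -/

namespace CategoryTheory.ProjectiveResolution

variable {X X' Y : ModuleCat.{u} R}

/-- A degree `n` cocycle with respect to a projective resolution has trivial class exactly when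
it is a coboundary; in degree `0` this means that it vanishes. -/
lemma extMk_eq_zero_iff_exists (P : ProjectiveResolution X) {n : ℕ}
    (f : P.complex.X n ⟶ Y) (m : ℕ) (hm : n + 1 = m) (hf : P.complex.d m n ≫ f = 0) :
    P.extMk f m hm hf = 0 ↔
      ∃ g : P.complex.X ((ComplexShape.up ℕ).prev n) ⟶ Y, P.complex.d n _ ≫ g = f := by
  rcases n with _ | p
  · constructor
    · intro h
      -- The resolution sits in cohomological degrees `≤ 0`, so a coboundary in degree `0` factors
      -- through the zero object in degree `1`. On the other side `prev 0` defaults to `0`, and `d 0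
      -- 0` vanishes.
      have hz : IsZero (P.cochainComplex.X 1) :=
        P.cochainComplex.isZero_of_isStrictlyLE 0 1 (by lia)
      rw [← P.extEquivCohomologyClass.apply_eq_iff_eq, extEquivCohomologyClass_extMk,
        extEquivCohomologyClass_zero, CochainComplex.HomComplex.CohomologyClass.mk_eq_zero_iff,
        CochainComplex.HomComplex.Cocycle.toSingleMk_mem_coboundaries_iff _ _ _ _ _ 1 (by simp)]
        at h
      obtain ⟨g, hg⟩ := h
      have : (P.cochainComplexXIso (-((0 : ℕ) : ℤ)) 0 rfl).hom ≫ f = 0 := by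
        rw [← hg, hz.eq_of_src g 0, comp_zero]
      refine ⟨0, ?_⟩
      rw [comp_zero]
      exact ((cancel_epi (P.cochainComplexXIso (-((0 : ℕ) : ℤ)) 0 rfl).hom).1
        (this.trans comp_zero.symm)).symm
    · rintro ⟨g, rfl⟩
      simp
  · have hp : (ComplexShape.up ℕ).prev (p + 1) = p := CochainComplex.prev_nat_succ p
    rw [P.extMk_eq_zero_iff f m hm hf p rfl, hp]

/-- Scalars act on classes of cocycles through the cocycles. -/
lemma smul_extMk (P : ProjectiveResolution X) {n : ℕ} (r : R)
    (f : P.complex.X n ⟶ Y) (m : ℕ) (hm : n + 1 = m) (hf : P.complex.d m n ≫ f = 0) :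
    r • P.extMk f m hm hf = P.extMk (r • f) m hm (by simp [hf]) := by
  simp [Ext.smul_eq_comp_mk₀, extMk_comp_mk₀]

variable (Y) in
/-- The cochain complex of homomorphisms from a projective resolution to `Y`. -/
noncomputable abbrev homComplex (P : ProjectiveResolution X) :
    CochainComplex (ModuleCat.{u} R) ℕ :=
  P.complex.linearYonedaObj R Y

/-- The homomorphism underlying a cocycle. -/
noncomputable def homOfCycles (P : ProjectiveResolution X) (n : ℕ) :
    (P.homComplex Y).cycles n →ₗ[R] (P.complex.X n ⟶ Y) :=
  ((P.homComplex Y).iCycles n).hom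

lemma homOfCycles_injective (P : ProjectiveResolution X) (n : ℕ) :
    Function.Injective (P.homOfCycles (Y := Y) n) :=
  (ModuleCat.mono_iff_injective ((P.homComplex Y).iCycles n)).1 inferInstance

lemma d_comp_homOfCycles (P : ProjectiveResolution X) {n : ℕ} (z : (P.homComplex Y).cycles n) :
    P.complex.d (n + 1) n ≫ P.homOfCycles n z = 0 := by
  have h := (P.homComplex Y).iCycles_d n (n + 1)
  exact congr($h z)

lemma homOfCycles_toCycles (P : ProjectiveResolution X) {m n : ℕ} (g : P.complex.X m ⟶ Y) :
    P.homOfCycles n ((P.homComplex Y).toCycles m n g) = P.complex.d n m ≫ g := by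
  have hi := (P.homComplex Y).toCycles_i m n
  exact congr($hi g)

lemma exists_homOfCycles_eq (P : ProjectiveResolution X) {n : ℕ} (f : P.complex.X n ⟶ Y)
    (hf : P.complex.d (n + 1) n ≫ f = 0) : ∃ z, P.homOfCycles n z = f := by
  have hex := ShortComplex.exact_of_f_is_kernel
    (ShortComplex.mk _ _ ((P.homComplex Y).iCycles_d n (n + 1)))
    ((P.homComplex Y).cyclesIsKernel n (n + 1) (by simp))
  rw [ShortComplex.moduleCat_exact_iff] at hex
  exact hex f hf

lemma homologyπ_eq_zero_iff (P : ProjectiveResolution X) {n : ℕ}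
    (z : (P.homComplex Y).cycles n) :
    (P.homComplex Y).homologyπ n z = 0 ↔
      ∃ g : P.complex.X ((ComplexShape.up ℕ).prev n) ⟶ Y,
        P.complex.d n _ ≫ g = P.homOfCycles n z := by
  have hex := ShortComplex.exact_of_g_is_cokernel
    (ShortComplex.mk _ _ ((P.homComplex Y).toCycles_comp_homologyπ
      ((ComplexShape.up ℕ).prev n) n))
    ((P.homComplex Y).homologyIsCokernel _ n rfl)
  rw [ShortComplex.moduleCat_exact_iff] at hex
  constructor
  · intro h
    obtain ⟨g, hg⟩ := hex z h
    exact ⟨g, (P.homOfCycles_toCycles g).symm.trans (congrArg (P.homOfCycles n) hg)⟩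
  · rintro ⟨g, hg⟩
    rw [← homOfCycles_toCycles] at hg
    obtain rfl := P.homOfCycles_injective n hg
    have hπ := (P.homComplex Y).toCycles_comp_homologyπ ((ComplexShape.up ℕ).prev n) n
    exact congr($hπ g)

/-- The class in `Ext` of a cocycle. -/
noncomputable def cyclesToExt (P : ProjectiveResolution X) (n : ℕ) :
    (P.homComplex Y).cycles n →ₗ[R] Ext X Y n where
  toFun z := P.extMk (P.homOfCycles n z) (n + 1) rfl (P.d_comp_homOfCycles z)
  map_add' x y := by simp [add_extMk]
  map_smul' r x := by simp [smul_extMk]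

lemma cyclesToExt_apply (P : ProjectiveResolution X) {n : ℕ} (z : (P.homComplex Y).cycles n) :
    P.cyclesToExt n z = P.extMk (P.homOfCycles n z) (n + 1) rfl (P.d_comp_homOfCycles z) :=
  rfl

lemma cyclesToExt_surjective (P : ProjectiveResolution X) (n : ℕ) :
    Function.Surjective (P.cyclesToExt (Y := Y) n) := by
  intro e
  obtain ⟨f, hf, rfl⟩ := P.extMk_surjective e (n + 1) rfl
  obtain ⟨z, rfl⟩ := P.exists_homOfCycles_eq f hf
  exact ⟨z, rfl⟩

/-- Homology and `Ext` are both quotients of the module of cocycles, so equal kernels identify them.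
-/
lemma ker_homologyπ (P : ProjectiveResolution X) (n : ℕ) :
    LinearMap.ker ((P.homComplex Y).homologyπ n).hom =
      LinearMap.ker (P.cyclesToExt (Y := Y) n) := by
  ext z
  rw [LinearMap.mem_ker, LinearMap.mem_ker, cyclesToExt_apply, extMk_eq_zero_iff_exists]
  exact P.homologyπ_eq_zero_iff z

/-- The cohomology of the complex of homomorphisms from a projective resolution is `Ext`. -/
noncomputable def homologyEquivExt (P : ProjectiveResolution X) (n : ℕ) :
    (P.homComplex Y).homology n ≃ₗ[R] Ext X Y n :=
  (LinearMap.quotKerEquivOfSurjective ((P.homComplex Y).homologyπ n).hom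
    ((ModuleCat.epi_iff_surjective _).1 inferInstance)).symm ≪≫ₗ
  Submodule.quotEquivOfEq _ _ (P.ker_homologyπ n) ≪≫ₗ
  LinearMap.quotKerEquivOfSurjective (P.cyclesToExt n) (P.cyclesToExt_surjective n)

lemma homologyEquivExt_homologyπ (P : ProjectiveResolution X) (n : ℕ)
    (z : (P.homComplex Y).cycles n) :
    P.homologyEquivExt n ((P.homComplex Y).homologyπ n z) = P.cyclesToExt n z := by
  have : (LinearMap.quotKerEquivOfSurjective ((P.homComplex Y).homologyπ n).hom
      ((ModuleCat.epi_iff_surjective _).1 inferInstance)).symm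
        ((P.homComplex Y).homologyπ n z) = Submodule.Quotient.mk z := by
    rw [LinearEquiv.symm_apply_eq]
    rfl
  simp only [homologyEquivExt, LinearEquiv.trans_apply, this]
  rfl

variable (Y) in
/-- The map of complexes of homomorphisms induced by a map of projective resolutions. -/
noncomputable def homComplexMap {P : ProjectiveResolution X} {P' : ProjectiveResolution X'}
    {f : X ⟶ X'} (φ : Hom P P' f) : P'.homComplex Y ⟶ P.homComplex Y :=
  (HomologicalComplex.unopFunctor _ _).map
    ((((linearYoneda R (ModuleCat.{u} R)).obj Y).rightOp.mapHomologicalComplex _).map φ.hom).op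

lemma homologyEquivExt_naturality {P : ProjectiveResolution X} {P' : ProjectiveResolution X'}
    {f : X ⟶ X'} (φ : Hom P P' f) (n : ℕ) (x : (P'.homComplex Y).homology n) :
    P.homologyEquivExt n (HomologicalComplex.homologyMap (homComplexMap Y φ) n x) =
      (Ext.mk₀ f).comp (P'.homologyEquivExt n x) (zero_add n) := by
  obtain ⟨z, rfl⟩ := (ModuleCat.epi_iff_surjective ((P'.homComplex Y).homologyπ n)).1
    inferInstance x
  have h := HomologicalComplex.homologyπ_naturality (homComplexMap Y φ) n
  have hx : HomologicalComplex.homologyMap (homComplexMap Y φ) n ((P'.homComplex Y).homologyπ n z)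
    = (P.homComplex Y).homologyπ n (HomologicalComplex.cyclesMap (homComplexMap Y φ) n z) :=
    congr($h z)
  rw [hx, homologyEquivExt_homologyπ, homologyEquivExt_homologyπ]
  have hc := HomologicalComplex.cyclesMap_i (homComplexMap Y φ) n
  have hz : P.homOfCycles n (HomologicalComplex.cyclesMap (homComplexMap Y φ) n z) =
      φ.hom.f n ≫ P'.homOfCycles n z := congr($hc z)
  simp only [cyclesToExt_apply, mk₀_comp_extMk (φ := φ), hz]

/-- Pastes the naturality squares of `isoLeftDerivedObj` and `homologyOp`, whose composite underlies
`isoExt`. -/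
lemma inv_comp_inv_comp_of_comp_eq {C : Type*} [Category* C] {A A' B B' E E' : C}
    (p : A ≅ B) (p' : A' ≅ B') (o : B ≅ E) (o' : B' ≅ E') {l : A ⟶ A'} {b : B ⟶ B'} {e : E ⟶ E'}
    (hp : p.inv ≫ l = b ≫ p'.inv) (ho : b ≫ o'.hom = o.hom ≫ e) :
    o.inv ≫ p.inv ≫ l = e ≫ o'.inv ≫ p'.inv := by
  rw [hp, Iso.inv_comp_eq, ← Category.assoc o.hom, ← ho]
  simp

lemma isoExt_naturality {P : ProjectiveResolution X} {P' : ProjectiveResolution X'}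
    {f : X ⟶ X'} (φ : Hom P P' f) (n : ℕ) :
    ((_root_.Ext R (ModuleCat.{u} R) n).map f.op).app Y ≫ (P.isoExt n Y).hom =
      (P'.isoExt n Y).hom ≫ HomologicalComplex.homologyMap (homComplexMap Y φ) n := by
  have h₁ := isoLeftDerivedObj_inv_naturality f P P' φ.hom
    (by simpa using φ.hom_f_zero_comp_π_f_zero)
    ((linearYoneda R (ModuleCat.{u} R)).obj Y).rightOp n
  have h₂ := HomologicalComplex.homologyOp_hom_naturality (homComplexMap Y φ) n
  exact congr($(inv_comp_inv_comp_of_comp_eq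
    (P.isoLeftDerivedObj ((linearYoneda R (ModuleCat.{u} R)).obj Y).rightOp n)
    (P'.isoLeftDerivedObj ((linearYoneda R (ModuleCat.{u} R)).obj Y).rightOp n)
    ((P.homComplex Y).homologyOp n) ((P'.homComplex Y).homologyOp n) h₁ h₂).unop)

end CategoryTheory.ProjectiveResolution

/-- Comparison of the two definitions of `Ext` for modules: the one as a derived functor and the one
as morphisms in the derived category. -/
noncomputable def derivedFunctorExtEquiv (X Y : ModuleCat.{u} R) (n : ℕ) :
    ((_root_.Ext R (ModuleCat.{u} R) n).obj (op X)).obj Y ≃ₗ[R] Abelian.Ext X Y n :=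
  ((projectiveResolution X).isoExt n Y).toLinearEquiv ≪≫ₗ
    (projectiveResolution X).homologyEquivExt n

/-- Naturality in the first variable matches the transition maps of the two direct systems. -/
lemma derivedFunctorExtEquiv_naturality {X X' : ModuleCat.{u} R} (Y : ModuleCat.{u} R) (f : X ⟶ X')
    (n : ℕ) (e : ((_root_.Ext R (ModuleCat.{u} R) n).obj (op X')).obj Y) :
    derivedFunctorExtEquiv X Y n (((_root_.Ext R (ModuleCat.{u} R) n).map f.op).app Y e) =
      (Abelian.Ext.mk₀ f).comp (derivedFunctorExtEquiv X' Y n e) (zero_add n) := by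
  let φ : ProjectiveResolution.Hom (projectiveResolution X) (projectiveResolution X') f :=
    ⟨ProjectiveResolution.lift f _ _, by
      simpa using ProjectiveResolution.lift_commutes_zero f _ _⟩
  have h := ProjectiveResolution.isoExt_naturality (Y := Y) φ n
  have he := congr($h e)
  refine Eq.trans (congrArg ((projectiveResolution X).homologyEquivExt n) he) ?_
  exact ProjectiveResolution.homologyEquivExt_naturality φ n _

/-! ### Local cohomology as a direct limit of `Ext` modules. -/

namespace localCohomology

/-- The projection from `R ⧸ I ^ t` to `R ⧸ I ^ s` for `s ≤ t`. -/
def powQuotientMap (I : Ideal R) {s t : ℕ} (h : s ≤ t) :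
    ModuleCat.of R (R ⧸ I ^ t) ⟶ ModuleCat.of R (R ⧸ I ^ s) :=
  ModuleCat.ofHom (Submodule.mapQ _ _ LinearMap.id (Ideal.pow_le_pow_right h))

lemma powQuotientMap_self (I : Ideal R) (t : ℕ) : powQuotientMap I (le_refl t) = 𝟙 _ := by
  ext
  rfl

lemma powQuotientMap_comp (I : Ideal R) {s t r : ℕ} (h : s ≤ t) (h' : t ≤ r) :
    powQuotientMap I h' ≫ powQuotientMap I h = powQuotientMap I (h.trans h') := by
  ext
  rfl

/-- The transition map `Ext^n(R ⧸ I ^ s, M) → Ext^n(R ⧸ I ^ t, M)` for `s ≤ t`. -/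
noncomputable def extMap (I : Ideal R) (M : ModuleCat.{u} R) (n : ℕ) (s t : ℕ) (h : s ≤ t) :
    Abelian.Ext (ModuleCat.of R (R ⧸ I ^ s)) M n →ₗ[R]
      Abelian.Ext (ModuleCat.of R (R ⧸ I ^ t)) M n :=
  (Abelian.Ext.mk₀ (powQuotientMap I h)).precompOfLinear R M (zero_add n)

lemma extMap_apply (I : Ideal R) (M : ModuleCat.{u} R) (n : ℕ) {s t : ℕ} (h : s ≤ t)
    (e : Abelian.Ext (ModuleCat.of R (R ⧸ I ^ s)) M n) :
    extMap I M n s t h e = (Abelian.Ext.mk₀ (powQuotientMap I h)).comp e (zero_add n) :=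
  rfl

instance (I : Ideal R) (M : ModuleCat.{u} R) (n : ℕ) :
    DirectedSystem (fun t => Abelian.Ext (ModuleCat.of R (R ⧸ I ^ t)) M n)
      (fun s t h => extMap I M n s t h) where
  map_self t e := by rw [extMap_apply, powQuotientMap_self, Abelian.Ext.mk₀_id_comp]
  map_map s t r h h' e := by
    rw [extMap_apply, extMap_apply, extMap_apply, Abelian.Ext.mk₀_comp_mk₀_assoc,
      powQuotientMap_comp]

/-- Local cohomology as the direct limit of the modules `Ext^n(R ⧸ I ^ t, M)`. -/
abbrev ExtLimit (I : Ideal R) (M : ModuleCat.{u} R) (n : ℕ) : Type u :=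
  Module.DirectLimit (fun t => Abelian.Ext (ModuleCat.of R (R ⧸ I ^ t)) M n) (extMap I M n)

/-- The map from `Ext^n(R ⧸ I ^ t, M)` to the direct limit. -/
noncomputable abbrev toExtLimit (I : Ideal R) (M : ModuleCat.{u} R) (n t : ℕ) :
    Abelian.Ext (ModuleCat.of R (R ⧸ I ^ t)) M n →ₗ[R] ExtLimit I M n :=
  Module.DirectLimit.of R ℕ (fun t => Abelian.Ext (ModuleCat.of R (R ⧸ I ^ t)) M n)
    (extMap I M n) t

lemma toExtLimit_extMap (I : Ideal R) (M : ModuleCat.{u} R) (n : ℕ) {s t : ℕ} (h : s ≤ t)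
    (e : Abelian.Ext (ModuleCat.of R (R ⧸ I ^ s)) M n) :
    toExtLimit I M n t (extMap I M n s t h e) = toExtLimit I M n s e :=
  Module.DirectLimit.of_f

lemma exists_toExtLimit_eq (I : Ideal R) (M : ModuleCat.{u} R) (n : ℕ) (x : ExtLimit I M n) :
    ∃ t e, toExtLimit I M n t e = x :=
  Module.DirectLimit.exists_of x

lemma exists_extMap_eq_zero (I : Ideal R) (M : ModuleCat.{u} R) (n : ℕ) {s : ℕ}
    {e : Abelian.Ext (ModuleCat.of R (R ⧸ I ^ s)) M n} (he : toExtLimit I M n s e = 0) :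
    ∃ t, ∃ h : s ≤ t, extMap I M n s t h e = 0 :=
  Module.DirectLimit.of.zero_exact he

/-- The structure map from `Ext^n(R ⧸ I ^ t, M)` to local cohomology. -/
noncomputable def fromExt (I : Ideal R) (M : ModuleCat.{u} R) (n t : ℕ) :
    Abelian.Ext (ModuleCat.of R (R ⧸ I ^ t)) M n →ₗ[R] (localCohomology I n).obj M :=
  ((colimit.ι (diagram (idealPowersDiagram I) n) (op (op t))).app M).hom ∘ₗ
    (derivedFunctorExtEquiv (ModuleCat.of R (R ⧸ I ^ t)) M n).symm.toLinearMap

lemma fromExt_derivedFunctorExtEquiv (I : Ideal R) (M : ModuleCat.{u} R) (n t : ℕ)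
    (e : ((_root_.Ext R (ModuleCat.{u} R) n).obj (op (ModuleCat.of R (R ⧸ I ^ t)))).obj M) :
    fromExt I M n t (derivedFunctorExtEquiv (ModuleCat.of R (R ⧸ I ^ t)) M n e) =
      (colimit.ι (diagram (idealPowersDiagram I) n) (op (op t))).app M e :=
  congrArg ((colimit.ι (diagram (idealPowersDiagram I) n) (op (op t))).app M)
    (LinearEquiv.symm_apply_apply _ e)

lemma derivedFunctorExtEquiv_diagram_map (I : Ideal R) (M : ModuleCat.{u} R) (n : ℕ) {s t : ℕ}
    (h : s ≤ t) (f : op (op s) ⟶ op (op t))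
    (e : ((_root_.Ext R (ModuleCat.{u} R) n).obj (op (ModuleCat.of R (R ⧸ I ^ s)))).obj M) :
    derivedFunctorExtEquiv (ModuleCat.of R (R ⧸ I ^ t)) M n
      (((diagram (idealPowersDiagram I) n).map f).app M e) =
      extMap I M n s t h (derivedFunctorExtEquiv (ModuleCat.of R (R ⧸ I ^ s)) M n e) :=
  derivedFunctorExtEquiv_naturality M (powQuotientMap I h) n e

lemma fromExt_extMap (I : Ideal R) (M : ModuleCat.{u} R) (n : ℕ) {s t : ℕ}
    (h : s ≤ t) (e : Abelian.Ext (ModuleCat.of R (R ⧸ I ^ s)) M n) :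
    fromExt I M n t (extMap I M n s t h e) = fromExt I M n s e := by
  obtain ⟨e, rfl⟩ := (derivedFunctorExtEquiv (ModuleCat.of R (R ⧸ I ^ s)) M n).surjective e
  rw [← derivedFunctorExtEquiv_diagram_map I M n h (homOfLE h).op.op]
  have hw := NatTrans.congr_app
    (colimit.w (diagram (idealPowersDiagram I) n) (homOfLE h).op.op) M
  exact ((fromExt_derivedFunctorExtEquiv I M n t _).trans congr($hw e)).trans
    (fromExt_derivedFunctorExtEquiv I M n s e).symm

/-- The index category `ℕᵒᵖᵒᵖ` lives in universe `0`, the modules in universe `u`. -/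
instance : PreservesFilteredColimitsOfSize.{0, 0} (forget (ModuleCat.{u} R)) :=
  preservesFilteredColimitsOfSize_shrink.{0, u, 0, u} _

/-- The evaluation at `M` of the colimit defining local cohomology is a colimit. -/
noncomputable def isColimitEvaluation (I : Ideal R) (M : ModuleCat.{u} R) (n : ℕ) :
    IsColimit (((evaluation _ _).obj M).mapCocone
      (colimit.cocone (diagram (idealPowersDiagram I) n))) :=
  isColimitOfPreserves _ (colimit.isColimit _)

lemma exists_fromExt_eq (I : Ideal R) (M : ModuleCat.{u} R) (n : ℕ)
    (x : (localCohomology I n).obj M) : ∃ t e, fromExt I M n t e = x := by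
  obtain ⟨⟨⟨t⟩⟩, e, he⟩ := Concrete.isColimit_exists_rep _ (isColimitEvaluation I M n) x
  refine ⟨t, derivedFunctorExtEquiv (ModuleCat.of R (R ⧸ I ^ t)) M n e, ?_⟩
  exact (fromExt_derivedFunctorExtEquiv I M n t e).trans he

lemma exists_extMap_eq_zero_of_fromExt (I : Ideal R) (M : ModuleCat.{u} R) (n : ℕ) {s : ℕ}
    {e : Abelian.Ext (ModuleCat.of R (R ⧸ I ^ s)) M n} (he : fromExt I M n s e = 0) :
    ∃ t, ∃ h : s ≤ t, extMap I M n s t h e = 0 := by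
  obtain ⟨e, rfl⟩ := (derivedFunctorExtEquiv (ModuleCat.of R (R ⧸ I ^ s)) M n).surjective e
  rw [fromExt_derivedFunctorExtEquiv] at he
  obtain ⟨⟨⟨t⟩⟩, f, g, hfg⟩ := Concrete.isColimit_exists_of_rep_eq _
    (isColimitEvaluation I M n) (i := op (op s)) (j := op (op s)) e 0
    (he.trans (map_zero ((colimit.ι (diagram (idealPowersDiagram I) n) (op (op s))).app M).hom).symm)
  refine ⟨t, f.unop.unop.le, ?_⟩
  rw [← derivedFunctorExtEquiv_diagram_map I M n _ f]
  exact (congrArg (derivedFunctorExtEquiv (ModuleCat.of R (R ⧸ I ^ t)) M n)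
    (hfg.trans (map_zero (((diagram (idealPowersDiagram I) n).map g).app M).hom))).trans
      (map_zero (derivedFunctorExtEquiv (ModuleCat.of R (R ⧸ I ^ t)) M n))

/-- Local cohomology is the direct limit of the modules `Ext^n(R ⧸ I ^ t, M)`. -/
noncomputable def extLimitEquiv (I : Ideal R) (M : ModuleCat.{u} R) (n : ℕ) :
    ExtLimit I M n ≃ₗ[R] (localCohomology I n).obj M :=
  LinearEquiv.ofBijective
    (Module.DirectLimit.lift R ℕ _ _ (fromExt I M n) fun _ _ h e => fromExt_extMap I M n h e) <| by
  constructor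
  · rw [injective_iff_map_eq_zero]
    intro x hx
    obtain ⟨s, e, rfl⟩ := exists_toExtLimit_eq I M n x
    rw [Module.DirectLimit.lift_of] at hx
    obtain ⟨t, h, he⟩ := exists_extMap_eq_zero_of_fromExt I M n hx
    rw [← toExtLimit_extMap I M n h, he, map_zero]
  · intro x
    obtain ⟨t, e, rfl⟩ := exists_fromExt_eq I M n x
    exact ⟨toExtLimit I M n t e, Module.DirectLimit.lift_of _ _ _⟩

end localCohomology

/-! ### Artin–Rees and vanishing for `I`-power torsion modules. -/

/-- A map of short exact sequences with projective middle term in the target which induces zero on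
`Ext^n` of the left terms induces zero on `Ext^(n+1)` of the right terms. -/
lemma CategoryTheory.ShortComplex.ShortExact.mk₀_τ₃_comp_eq_zero {S' S : ShortComplex (ModuleCat.{u} R)}
    (hS' : S'.ShortExact) (hS : S.ShortExact) [Projective S.X₂] (φ : S' ⟶ S)
    {N : ModuleCat.{u} R} {n : ℕ}
    (h : ∀ x : Ext S.X₁ N n, (Ext.mk₀ φ.τ₁).comp x (zero_add n) = 0) (e : Ext S.X₃ N (n + 1)) :
    (Ext.mk₀ φ.τ₃).comp e (zero_add _) = 0 := by
  -- Since `S.X₂` is projective, every class in positive degree is a product with the extension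
  -- class, which is natural in the sequence.
  obtain ⟨x, rfl⟩ := precomp_extClass_surjective_of_projective_X₂ N hS n e
  change (Ext.mk₀ φ.τ₃).comp (hS.extClass.comp x (add_comm 1 n)) (zero_add _) = 0
  rw [← Ext.comp_assoc (Ext.mk₀ φ.τ₃) hS.extClass x (zero_add 1) _ (by lia),
    ← ShortExact.extClass_naturality hS' hS φ,
    Ext.comp_assoc hS'.extClass (Ext.mk₀ φ.τ₁) x (add_zero 1) (zero_add n) (by lia), h,
    Ext.comp_zero]

/-- A surjective linear map restricts to a surjection from `J • ⊤` onto `J • ⊤`. -/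
def LinearMap.restrictSMulTop {F A : Type*} [AddCommGroup F] [Module R F] [AddCommGroup A]
    [Module R A] (p : F →ₗ[R] A) (J : Ideal R) :
    (J • ⊤ : Submodule R F) →ₗ[R] (J • ⊤ : Submodule R A) :=
  p.restrict fun x hx => by
    have : p x ∈ (J • ⊤ : Submodule R F).map p := ⟨x, hx, rfl⟩
    rw [Submodule.map_smul''] at this
    exact Submodule.smul_mono le_rfl le_top this

lemma LinearMap.restrictSMulTop_surjective {F A : Type*} [AddCommGroup F] [Module R F]
    [AddCommGroup A] [Module R A] {p : F →ₗ[R] A} (hp : Function.Surjective p) (J : Ideal R) :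
    Function.Surjective (p.restrictSMulTop J) := by
  rintro ⟨y, hy⟩
  rw [← LinearMap.range_eq_top.2 hp, LinearMap.range_eq_map, ← Submodule.map_smul''] at hy
  obtain ⟨x, hx, rfl⟩ := hy
  exact ⟨⟨x, hx⟩, rfl⟩

/-- If a power of `I` annihilates `N`, then for finitely generated `A` the restriction
`Ext^i(A, N) → Ext^i(I ^ n A, N)` vanishes for some `n`, by the Artin–Rees lemma. -/
theorem exists_mk₀_subtype_comp_eq_zero [IsNoetherianRing R] (I : Ideal R) (N : ModuleCat.{u} R)
    {k : ℕ} (hN : ∀ a ∈ I ^ k, ∀ y : N, a • y = 0) (i : ℕ) (A : ModuleCat.{u} R)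
    [Module.Finite R A] :
    ∃ n, ∀ e : Ext A N i,
      (Ext.mk₀ (ModuleCat.ofHom (I ^ n • ⊤ : Submodule R A).subtype)).comp e (zero_add i) = 0 := by
  induction i generalizing A with
  | zero =>
    refine ⟨k, fun e => ?_⟩
    obtain ⟨f, rfl⟩ := Ext.addEquiv₀.symm.surjective e
    change (Ext.mk₀ _).comp (Ext.mk₀ f) _ = 0
    rw [Ext.mk₀_comp_mk₀, Ext.mk₀_eq_zero_iff]
    ext ⟨x, hx⟩
    change f.hom x = 0
    refine Submodule.smul_induction_on hx (fun a ha y _ => ?_) fun x y hx hy => ?_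
    · rw [map_smul, hN a ha]
    · rw [map_add, hx, hy, add_zero]
  | succ i ih =>
    -- Dimension shift to the syzygy `K = ker p`. With `c` the Artin–Rees constant, `I^(m+c) F ∩ K =
    -- I^m (I^c F ∩ K) ⊆ I^m K`, and restriction to `I^m K` kills `Ext^i(K, N)`.
    obtain ⟨F, _, _, _, _, p, hp⟩ := Module.exists_finite_presentation R A
    obtain ⟨m, hm⟩ := ih (ModuleCat.of R (LinearMap.ker p))
    obtain ⟨c, hc⟩ := I.exists_pow_inf_eq_pow_smul (LinearMap.ker p)
    have hK : ∀ x : F, x ∈ (I ^ (m + c) • ⊤ : Submodule R F) → (hx : x ∈ LinearMap.ker p) →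
        (⟨x, hx⟩ : LinearMap.ker p) ∈ (I ^ m • ⊤ : Submodule R (LinearMap.ker p)) := by
      intro x h₁ h₂
      have h : x ∈ I ^ (m + c) • ⊤ ⊓ LinearMap.ker p := ⟨h₁, h₂⟩
      rw [hc (m + c) (by lia), Nat.add_sub_cancel] at h
      have hx : x ∈ I ^ m • LinearMap.ker p := Submodule.smul_mono le_rfl inf_le_right h
      rw [← Submodule.range_subtype (LinearMap.ker p), LinearMap.range_eq_map,
        ← Submodule.map_smul''] at hx
      obtain ⟨y, hy, rfl⟩ := hx
      exact hy
    refine ⟨m + c, fun e => ?_⟩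
    let q := p.restrictSMulTop (I ^ (m + c))
    have hS := LinearMap.shortExact_shortComplexKer hp
    have hS' := LinearMap.shortExact_shortComplexKer
      (LinearMap.restrictSMulTop_surjective hp (I ^ (m + c)))
    let j : LinearMap.ker q →ₗ[R] (I ^ m • ⊤ : Submodule R (LinearMap.ker p)) :=
      LinearMap.codRestrict _ (LinearMap.codRestrict (LinearMap.ker p)
        (Submodule.subtype _ ∘ₗ (LinearMap.ker q).subtype)
        fun x => congrArg Subtype.val x.2) fun x => hK _ x.1.2 _
    let φ : q.shortComplexKer ⟶ p.shortComplexKer :=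
      { τ₁ := ModuleCat.ofHom j ≫ ModuleCat.ofHom (Submodule.subtype _)
        τ₂ := ModuleCat.ofHom (Submodule.subtype _)
        τ₃ := ModuleCat.ofHom (Submodule.subtype _)
        comm₁₂ := rfl
        comm₂₃ := rfl }
    have : Projective p.shortComplexKer.X₂ := (IsProjective.iff_projective F).1 inferInstance
    refine ShortComplex.ShortExact.mk₀_τ₃_comp_eq_zero hS' hS φ (fun x => ?_) e
    change (Ext.mk₀ (_ ≫ _)).comp x _ = 0
    rw [← Ext.mk₀_comp_mk₀, Ext.comp_assoc_of_second_deg_zero, hm, Ext.comp_zero]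

namespace localCohomology

/-- Positive local cohomology of a module annihilated by a power of `I` vanishes. -/
theorem exists_extMap_eq_zero_of_pow_smul_eq_zero [IsNoetherianRing R] (I : Ideal R)
    (N : ModuleCat.{u} R) {k : ℕ} (hN : ∀ a ∈ I ^ k, ∀ y : N, a • y = 0) (i s : ℕ) :
    ∃ t, ∃ h : s ≤ t, ∀ e, extMap I N (i + 1) s t h e = 0 := by
  -- Here the syzygy of `R ⧸ I^s` is `I^s`, and `I^(s+n) = I^n · I^s`; one further shift along `R →
  -- R ⧸ I^s` raises the degree to `i + 1`.
  obtain ⟨n, hn⟩ := exists_mk₀_subtype_comp_eq_zero I N hN i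
    (ModuleCat.of R (LinearMap.ker (I ^ s).mkQ))
  have hj : ∀ (x : R), x ∈ LinearMap.ker (I ^ (s + n)).mkQ → ∃ hx : x ∈ LinearMap.ker (I ^ s).mkQ,
      (⟨x, hx⟩ : LinearMap.ker (I ^ s).mkQ) ∈
        (I ^ n • ⊤ : Submodule R (LinearMap.ker (I ^ s).mkQ)) := by
    intro x hx
    rw [Submodule.ker_mkQ, pow_add, mul_comm, ← smul_eq_mul] at hx
    rw [← Submodule.ker_mkQ (I ^ s)] at hx
    rw [← Submodule.range_subtype (LinearMap.ker (I ^ s).mkQ), LinearMap.range_eq_map,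
        ← Submodule.map_smul''] at hx
    obtain ⟨y, hy, rfl⟩ := hx
    exact ⟨y.2, hy⟩
  refine ⟨s + n, by lia, fun e => ?_⟩
  have hS := LinearMap.shortExact_shortComplexKer (I ^ s).mkQ_surjective
  have hS' := LinearMap.shortExact_shortComplexKer (I ^ (s + n)).mkQ_surjective
  let j : LinearMap.ker (I ^ (s + n)).mkQ →ₗ[R]
      (I ^ n • ⊤ : Submodule R (LinearMap.ker (I ^ s).mkQ)) :=
    LinearMap.codRestrict _ (LinearMap.codRestrict (LinearMap.ker (I ^ s).mkQ)
      (Submodule.subtype _) fun x => (hj x.1 x.2).1) fun x => (hj x.1 x.2).2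
  let φ : (I ^ (s + n)).mkQ.shortComplexKer ⟶ (I ^ s).mkQ.shortComplexKer :=
    { τ₁ := ModuleCat.ofHom j ≫ ModuleCat.ofHom (Submodule.subtype _)
      τ₂ := 𝟙 _
      τ₃ := powQuotientMap I (Nat.le_add_right s n)
      comm₁₂ := rfl
      comm₂₃ := rfl }
  have : Projective (I ^ s).mkQ.shortComplexKer.X₂ :=
    (IsProjective.iff_projective R).1 inferInstance
  refine ShortComplex.ShortExact.mk₀_τ₃_comp_eq_zero hS' hS φ (fun x => ?_) e
  change (Ext.mk₀ (_ ≫ _)).comp x _ = 0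
  rw [← Ext.mk₀_comp_mk₀, Ext.comp_assoc_of_second_deg_zero, hn, Ext.comp_zero]

/-! ### Maps between local cohomology modules, and torsion. -/

/-- The map on direct limits induced by composition with a class in `Ext`. -/
noncomputable def extLimitMap (I : Ideal R) {M N : ModuleCat.{u} R} {m n k : ℕ}
    (α : Ext M N k) (h : m + k = n) : ExtLimit I M m →ₗ[R] ExtLimit I N n :=
  Module.DirectLimit.map (fun t => α.postcompOfLinear R (ModuleCat.of R (R ⧸ I ^ t)) h)
    fun s t hst => by
      ext e
      change ((Ext.mk₀ (powQuotientMap I hst)).comp e (zero_add m)).comp α h =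
        (Ext.mk₀ (powQuotientMap I hst)).comp (e.comp α h) (zero_add n)
      rw [Ext.comp_assoc _ _ _ (zero_add m) h (by lia)]

lemma extLimitMap_toExtLimit (I : Ideal R) {M N : ModuleCat.{u} R} {m n k : ℕ}
    (α : Ext M N k) (h : m + k = n) (t : ℕ) (e : Ext (ModuleCat.of R (R ⧸ I ^ t)) M m) :
    extLimitMap I α h (toExtLimit I M m t e) = toExtLimit I N n t (e.comp α h) :=
  Module.DirectLimit.map_apply_of _ _ _

/-- Local cohomology in positive degree embeds into that of the quotient by a submodule annihilated
by a power of `I`. -/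
theorem extLimitMap_injective [IsNoetherianRing R] (I : Ideal R) {S : ShortComplex (ModuleCat.{u} R)}
    (hS : S.ShortExact) {k : ℕ} (hN : ∀ a ∈ I ^ k, ∀ y : S.X₁, a • y = 0) (n : ℕ) :
    Function.Injective (extLimitMap I (Ext.mk₀ S.g) (add_zero (n + 1))) := by
  rw [injective_iff_map_eq_zero]
  intro x hx
  obtain ⟨s, e, rfl⟩ := exists_toExtLimit_eq I _ _ x
  rw [extLimitMap_toExtLimit] at hx
  obtain ⟨t, hst, ht⟩ := exists_extMap_eq_zero I _ _ hx
  rw [extMap_apply, ← Ext.comp_assoc _ _ _ (zero_add _) _ (by lia)] at ht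
  -- At stage `t` the class comes from `S.X₁`, whose contribution dies at a later stage `r`.
  obtain ⟨x₁, hx₁⟩ := Ext.covariant_sequence_exact₂ _ hS _ ht
  obtain ⟨r, htr, hr⟩ := exists_extMap_eq_zero_of_pow_smul_eq_zero I S.X₁ hN n t
  have h := hr x₁
  rw [← toExtLimit_extMap I _ _ hst, extMap_apply, ← hx₁, ← toExtLimit_extMap I _ _ htr,
    extMap_apply, ← Ext.comp_assoc _ _ _ (zero_add _) _ (by lia), ← extMap_apply, h,
    Ext.zero_comp, map_zero]

/-- If `x` is regular on `M`, then the `x`-torsion of `H^(n+1)(M)` comes from `H^n(M ⧸ x M)`. -/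
theorem mem_range_extLimitMap_of_smul_eq_zero (I : Ideal R) {M : ModuleCat.{u} R} {x : R}
    (hx : IsSMulRegular M x) (n : ℕ) (z : ExtLimit I M (n + 1)) (hz : x • z = 0) :
    z ∈ LinearMap.range
      (extLimitMap I hx.smulShortComplex_shortExact.extClass (rfl : n + 1 = n + 1)) := by
  obtain ⟨s, e, rfl⟩ := exists_toExtLimit_eq I _ _ z
  rw [← map_smul] at hz
  obtain ⟨t, hst, ht⟩ := exists_extMap_eq_zero I _ _ hz
  rw [map_smul, Ext.smul_eq_comp_mk₀] at ht
  rw [← toExtLimit_extMap I _ _ hst]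
  obtain ⟨x₃, hx₃⟩ := Ext.covariant_sequence_exact₁ _ hx.smulShortComplex_shortExact _ ht rfl
  refine ⟨toExtLimit I (M.smulShortComplex x).X₃ n t x₃, ?_⟩
  rw [extLimitMap_toExtLimit, hx₃]
  rfl

/-- Every element of local cohomology is annihilated by a power of the ideal. -/
theorem exists_pow_smul_eq_zero (I : Ideal R) (M : ModuleCat.{u} R) (n : ℕ)
    (z : ExtLimit I M n) : ∃ t : ℕ, ∀ a ∈ I ^ t, a • z = 0 := by
  obtain ⟨t, e, rfl⟩ := exists_toExtLimit_eq I _ _ z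
  refine ⟨t, fun a ha => ?_⟩
  have ha0 : a • 𝟙 (ModuleCat.of R (R ⧸ I ^ t)) = 0 := by
    ext
    change a • (Ideal.Quotient.mk (I ^ t) 1) = 0
    rw [← Ideal.Quotient.mk_eq_mk, ← Submodule.Quotient.mk_smul, Submodule.Quotient.mk_eq_zero]
    simpa using ha
  rw [← map_smul, ← Ext.mk₀_id_comp e, ← Ext.smul_comp, ← Ext.mk₀_smul, ha0, Ext.mk₀_zero,
    Ext.zero_comp, map_zero]

/-- `H^0(M)` embeds into `M`. -/
theorem exists_injective_extLimit_zero (I : Ideal R) (M : ModuleCat.{u} R) :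
    ∃ f : ExtLimit I M 0 →ₗ[R] M, Function.Injective f := by
  -- A map out of `R ⧸ I^t` is determined by its value at `1`, so evaluation there is injective at
  -- every stage, hence in the limit.
  let g (t : ℕ) : Ext (ModuleCat.of R (R ⧸ I ^ t)) M 0 →ₗ[R] M :=
    LinearMap.applyₗ (Ideal.Quotient.mk (I ^ t) 1) ∘ₗ ModuleCat.homLinearEquiv.toLinearMap ∘ₗ
      (Ext.linearEquiv₀ (R := R)).toLinearMap
  have hg (t : ℕ) (f : ModuleCat.of R (R ⧸ I ^ t) ⟶ M) :
      g t (Ext.mk₀ f) = f.hom (Ideal.Quotient.mk (I ^ t) 1) := by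
    have : Ext.linearEquiv₀ (R := R) (Ext.mk₀ f) = f := Ext.linearEquiv₀.apply_symm_apply f
    change (Ext.linearEquiv₀ (R := R) (Ext.mk₀ f)).hom _ = _
    rw [this]
  refine ⟨Module.DirectLimit.lift R ℕ _ _ g fun s t h e => ?_, Module.DirectLimit.lift_injective _ _
    fun t => ?_⟩
  · obtain ⟨f, rfl⟩ := Ext.linearEquiv₀ (R := R).symm.surjective e
    rw [Ext.linearEquiv₀_symm_apply, extMap_apply, Ext.mk₀_comp_mk₀, hg, hg]
    rfl
  · rw [injective_iff_map_eq_zero]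
    intro e he
    obtain ⟨f, rfl⟩ := Ext.linearEquiv₀ (R := R).symm.surjective e
    rw [Ext.linearEquiv₀_symm_apply, hg] at he
    rw [Ext.linearEquiv₀_symm_apply, Ext.mk₀_eq_zero_iff]
    ext
    exact he

end localCohomology

/-! ### Serre classes and closure properties of `(S₁, S₂)`. -/

namespace CategoryTheory.ObjectProperty

variable (S : ObjectProperty (ModuleCat.{u} R))

lemma prop_of_injective [S.IsClosedUnderSubobjects] {A B : Type u} [AddCommGroup A] [Module R A]
    [AddCommGroup B] [Module R B] {f : A →ₗ[R] B} (hf : Function.Injective f)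
    (hB : S (ModuleCat.of R B)) : S (ModuleCat.of R A) := by
  have : Mono (ModuleCat.ofHom f) := (ModuleCat.mono_iff_injective _).2 hf
  exact S.prop_of_mono (ModuleCat.ofHom f) hB

lemma prop_of_surjective [S.IsClosedUnderQuotients] {A B : Type u} [AddCommGroup A] [Module R A]
    [AddCommGroup B] [Module R B] {f : A →ₗ[R] B} (hf : Function.Surjective f)
    (hA : S (ModuleCat.of R A)) : S (ModuleCat.of R B) := by
  have : Epi (ModuleCat.ofHom f) := (ModuleCat.epi_iff_surjective _).2 hf
  exact S.prop_of_epi (ModuleCat.ofHom f) hA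

lemma prop_of_subsingleton [S.IsSerreClass] (A : Type u) [AddCommGroup A] [Module R A]
    [Subsingleton A] : S (ModuleCat.of R A) := by
  obtain ⟨Z, -, hS⟩ := S.exists_prop_of_containsZero
  exact S.prop_of_injective (f := (0 : A →ₗ[R] Z)) (Function.injective_of_subsingleton _) hS

end CategoryTheory.ObjectProperty

section extensionClass

variable {S₁ S₂ : ObjectProperty (ModuleCat.{u} R)} [S₁.IsSerreClass] [S₂.IsSerreClass]

/-- Replaces the exact sequence by a submodule, which can be pulled back along injections and pushed
forward along surjections. -/
lemma extensionClass_of_iff (M : Type u) [AddCommGroup M] [Module R M] :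
    extensionClass S₁ S₂ (ModuleCat.of R M) ↔
      ∃ A : Submodule R M, S₁ (ModuleCat.of R A) ∧ S₂ (ModuleCat.of R (M ⧸ A)) := by
  constructor
  · rintro ⟨A, B, f, g, w, hA, hB, h⟩
    have hf : Function.Injective f.hom := (ModuleCat.mono_iff_injective f).1 h.mono_f
    have hg : Function.Surjective g.hom := (ModuleCat.epi_iff_surjective g).1 h.epi_g
    have hfg := (ShortComplex.ShortExact.moduleCat_exact_iff_function_exact _).1 h.exact
    refine ⟨LinearMap.ker g.hom, ?_, ?_⟩
    · refine S₁.prop_of_surjective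
        (f := f.hom.codRestrict (LinearMap.ker g.hom) fun x => (hfg _).2 ⟨x, rfl⟩) ?_ hA
      rintro ⟨y, hy⟩
      obtain ⟨x, rfl⟩ := (hfg y).1 hy
      exact ⟨x, rfl⟩
    · exact S₂.prop_of_injective (f := (g.hom.quotKerEquivOfSurjective hg).toLinearMap)
        (LinearEquiv.injective _) hB
  · rintro ⟨A, h₁, h₂⟩
    refine ⟨ModuleCat.of R A, ModuleCat.of R (M ⧸ A), ModuleCat.ofHom A.subtype,
      ModuleCat.ofHom A.mkQ, by ext; simp, h₁, h₂, ?_⟩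
    exact
      { exact := (ShortComplex.ShortExact.moduleCat_exact_iff_function_exact _).2
          (LinearMap.exact_subtype_mkQ A)
        mono_f := (ModuleCat.mono_iff_injective _).2 A.injective_subtype
        epi_g := (ModuleCat.epi_iff_surjective _).2 A.mkQ_surjective }

lemma extensionClass_of_injective {M N : Type u} [AddCommGroup M] [Module R M]
    [AddCommGroup N] [Module R N] {f : M →ₗ[R] N} (hf : Function.Injective f)
    (hN : extensionClass S₁ S₂ (ModuleCat.of R N)) :
    extensionClass S₁ S₂ (ModuleCat.of R M) := by
  rw [extensionClass_of_iff] at hN ⊢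
  obtain ⟨A, h₁, h₂⟩ := hN
  refine ⟨A.comap f, S₁.prop_of_injective (f := f.restrict (p := A.comap f) fun x hx => hx) ?_ h₁,
    S₂.prop_of_injective (f := Submodule.mapQ (A.comap f) A f le_rfl) ?_ h₂⟩
  · exact fun x y h => Subtype.ext (hf (congrArg Subtype.val h))
  · rw [← LinearMap.ker_eq_bot, Submodule.ker_mapQ, Submodule.mkQ_map_self]

lemma extensionClass_of_surjective {M N : Type u} [AddCommGroup M] [Module R M]
    [AddCommGroup N] [Module R N] {f : M →ₗ[R] N} (hf : Function.Surjective f)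
    (hM : extensionClass S₁ S₂ (ModuleCat.of R M)) :
    extensionClass S₁ S₂ (ModuleCat.of R N) := by
  rw [extensionClass_of_iff] at hM ⊢
  obtain ⟨A, h₁, h₂⟩ := hM
  refine ⟨A.map f, S₁.prop_of_surjective
      (f := f.restrict (q := A.map f) fun x hx => Submodule.mem_map_of_mem hx) ?_ h₁,
    S₂.prop_of_surjective (f := Submodule.mapQ A (A.map f) f (Submodule.le_comap_map f A)) ?_ h₂⟩
  · rintro ⟨_, x, hx, rfl⟩
    exact ⟨⟨x, hx⟩, rfl⟩
  · intro y
    obtain ⟨y, rfl⟩ := Submodule.mkQ_surjective _ y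
    obtain ⟨x, rfl⟩ := hf y
    exact ⟨A.mkQ x, rfl⟩

lemma extensionClass_of_left {M : Type u} [AddCommGroup M] [Module R M]
    (h : S₁ (ModuleCat.of R M)) : extensionClass S₁ S₂ (ModuleCat.of R M) := by
  rw [extensionClass_of_iff]
  exact ⟨⊤, S₁.prop_of_injective (Submodule.injective_subtype ⊤) h, S₂.prop_of_subsingleton _⟩

end extensionClass

/-! ### Modules supported at the maximal ideal. -/

section LocalRing

variable [IsLocalRing R]

/-- A nonzero `y` generates a submodule `R ⧸ ann y`; as `ann y` is proper, this surjects onto the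
residue field. -/
lemma prop_residueField {S : ObjectProperty (ModuleCat.{u} R)} [S.IsSerreClass]
    (N : ModuleCat.{u} R) (hN : S N) [Nontrivial N] :
    S (ModuleCat.of R (R ⧸ IsLocalRing.maximalIdeal R)) := by
  obtain ⟨y, hy⟩ := exists_ne (0 : N)
  have hle : LinearMap.ker (LinearMap.toSpanSingleton R N y) ≤ IsLocalRing.maximalIdeal R := by
    refine IsLocalRing.le_maximalIdeal fun h => hy ?_
    have : (1 : R) ∈ LinearMap.ker (LinearMap.toSpanSingleton R N y) := h ▸ Submodule.mem_top
    simpa using this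
  have h₁ : S (ModuleCat.of R (R ⧸ LinearMap.ker (LinearMap.toSpanSingleton R N y))) :=
    S.prop_of_injective (f := (LinearMap.ker (LinearMap.toSpanSingleton R N y)).liftQ _ le_rfl)
      (LinearMap.ker_eq_bot.1 (Submodule.ker_liftQ_eq_bot _ _ _ le_rfl)) hN
  exact S.prop_of_surjective (f := Submodule.factor hle) (Submodule.factor_surjective hle) h₁

/-- A Serre class containing a nonzero module contains all finitely generated modules supported only
at the maximal ideal. -/
theorem prop_of_support_subset [IsNoetherianRing R] {S : ObjectProperty (ModuleCat.{u} R)}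
    [S.IsSerreClass] (hS : S (ModuleCat.of R (R ⧸ IsLocalRing.maximalIdeal R)))
    (M : Type u) [AddCommGroup M] [Module R M] [hM : Module.Finite R M]
    (h : ∀ p ∈ Module.support R M, p.asIdeal = IsLocalRing.maximalIdeal R) :
    S (ModuleCat.of R M) := by
  -- Prime filtration: each factor `R ⧸ p` has `p` in its support, which forces `p` to be maximal.
  induction hM using IsNoetherianRing.induction_on_isQuotientEquivQuotientPrime R with
  | subsingleton N => exact S.prop_of_subsingleton N
  | quotient N p f =>
    have hp := h p (by
      rw [f.support_eq, Module.mem_support_iff_of_finite, Ideal.annihilator_quotient])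
    rw [hp] at f
    exact S.prop_of_injective f.injective hS
  | exact N₁ N₂ N₃ f g hf hg hfg h₁ h₃ =>
    have e : (ShortComplex.mk (ModuleCat.ofHom f) (ModuleCat.ofHom g)
        (by ext x; exact hfg.apply_apply_eq_zero x)).ShortExact :=
      { exact := (ShortComplex.ShortExact.moduleCat_exact_iff_function_exact _).2 hfg
        mono_f := (ModuleCat.mono_iff_injective _).2 hf
        epi_g := (ModuleCat.epi_iff_surjective _).2 hg }
    exact S.prop_X₂_of_shortExact e
      (h₁ fun p hp => h p (Module.support_subset_of_injective f hf hp))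
      (h₃ fun p hp => h p (Module.support_subset_of_surjective g hg hp))

/-- The bound `≤ 0` also admits the zero module, of dimension `⊥` and with empty support. -/
lemma asIdeal_eq_maximalIdeal_of_supportDim_le_zero [IsNoetherianRing R] {M : Type u}
    [AddCommGroup M] [Module R M] [Module.Finite R M] (hM : Module.supportDim R M ≤ 0)
    (p : PrimeSpectrum R) (hp : p ∈ Module.support R M) :
    p.asIdeal = IsLocalRing.maximalIdeal R := by
  have : Nontrivial M := Module.nonempty_support_iff.1 ⟨p, hp⟩
  have h0 : Module.supportDim R M = 0 := by
    refine le_antisymm hM ?_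
    have : Nonempty (Module.support R M) := ⟨⟨p, hp⟩⟩
    exact Order.krullDim_nonneg
  rw [support_of_supportDim_eq_zero R M h0, PrimeSpectrum.zeroLocus_eq_singleton] at hp
  exact congrArg PrimeSpectrum.asIdeal hp

end LocalRing

/-! ### Removing torsion, regular elements, and the drop in dimension. -/

section gammaTorsion

variable (I : Ideal R) (M : Type u) [AddCommGroup M] [Module R M]

lemma exists_pow_smul_gammaTorsion_eq_zero [IsNoetherianRing R] [Module.Finite R M] :
    ∃ k, ∀ a ∈ I ^ k, ∀ y : gammaTorsion I M, a • y = 0 := by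
  obtain ⟨s, hs⟩ := (IsNoetherian.noetherian (⊤ : Submodule R (gammaTorsion I M)))
  have hy (y : gammaTorsion I M) : ∃ n : ℕ, ∀ a ∈ I ^ n, a • y = 0 := by
    obtain ⟨n, hn⟩ := y.2
    exact ⟨n, fun a ha => Subtype.ext (hn a ha)⟩
  choose n hn using hy
  refine ⟨s.sup n, fun a ha y => ?_⟩
  have hle : (⊤ : Submodule R (gammaTorsion I M)) ≤
      LinearMap.ker (LinearMap.lsmul R (gammaTorsion I M) a) := by
    rw [← hs, Submodule.span_le]
    intro y hy
    exact hn y a (Ideal.pow_le_pow_right (Finset.le_sup hy) ha)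
  exact hle Submodule.mem_top

lemma gammaTorsion_quotient_eq_bot [IsNoetherianRing R] [Module.Finite R M] :
    gammaTorsion I (M ⧸ gammaTorsion I M) = ⊥ := by
  obtain ⟨k, hk⟩ := exists_pow_smul_gammaTorsion_eq_zero I M
  rw [eq_bot_iff]
  rintro x ⟨n, hn⟩
  obtain ⟨x, rfl⟩ := Submodule.mkQ_surjective _ x
  rw [Submodule.mem_bot, Submodule.mkQ_apply, Submodule.Quotient.mk_eq_zero]
  -- `I^n` carries `x` into `Γ_I(M)`, and `I^k` kills `Γ_I(M)`.
  refine ⟨k + n, fun a ha => ?_⟩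
  rw [pow_add] at ha
  refine Submodule.mul_induction_on ha (fun b hb c hc => ?_) fun b c hb hc => ?_
  · have hcx : c • x ∈ gammaTorsion I M := by
      rw [← Submodule.Quotient.mk_eq_zero, Submodule.Quotient.mk_smul]
      exact hn c hc
    rw [mul_smul]
    exact congrArg Subtype.val (hk b hb ⟨c • x, hcx⟩)
  · rw [add_smul, hb, hc, add_zero]

/-- Prime avoidance: otherwise `I` lies in one of the finitely many associated primes `ann y`, and
then `y` is a nonzero element of `Γ_I(M)`. -/
lemma exists_isSMulRegular_of_gammaTorsion_eq_bot [IsNoetherianRing R] [Module.Finite R M]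
    (h : gammaTorsion I M = ⊥) : ∃ x ∈ I, IsSMulRegular M x := by
  by_contra! hx
  have hsub : (I : Set R) ⊆ ⋃ p ∈ associatedPrimes R M, p := by
    rw [biUnion_associatedPrimes_eq_compl_regular]
    exact hx
  have hfin := associatedPrimes.finite R M
  have hsub' : (I : Set R) ⊆ ⋃ p ∈ (hfin.toFinset : Set (Ideal R)), (p : Set R) := by
    simpa using hsub
  obtain ⟨p, hp, hIp⟩ := (Ideal.subset_union_prime (f := fun p : Ideal R => p) ⊤ ⊤
    (fun p hp _ _ => (hfin.mem_toFinset.1 hp).isPrime)).1 hsub'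
  have hp := hfin.mem_toFinset.1 hp
  rw [AssociatedPrimes.mem_iff, isAssociatedPrime_iff] at hp
  obtain ⟨hprime, y, rfl⟩ := hp
  have hy : y ∈ gammaTorsion I M := ⟨1, fun a ha => by
    rw [pow_one] at ha
    simpa [Submodule.mem_colon_singleton] using hIp ha⟩
  rw [h, Submodule.mem_bot] at hy
  subst hy
  exact hprime.ne_top (by ext; simp [Submodule.mem_colon_singleton])

end gammaTorsion

/-- A regular element avoids the minimal primes of the support, so the dimension drops by at least
one; what remains is cancelling `1` in `WithBot ℕ∞`. -/
lemma supportDim_quotSMulTop_le [IsNoetherianRing R] {M : Type u} [AddCommGroup M] [Module R M]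
    [Module.Finite R M] {x : R} (hx : IsSMulRegular M x) {d : ℕ}
    (hd : Module.supportDim R M ≤ ((d + 1 : ℕ) : WithBot ℕ∞)) :
    Module.supportDim R (QuotSMulTop x M) ≤ (d : WithBot ℕ∞) := by
  have h := (Module.supportDim_quotSMulTop_succ_le_of_notMem_minimalPrimes
    (M := M) (x := x) fun _ => hx.notMem_of_mem_minimalPrimes).trans hd
  rw [Nat.cast_add, Nat.cast_one] at h
  generalize Module.supportDim R (QuotSMulTop x M) = a at h
  induction a with
  | bot => exact bot_le
  | coe a =>
    induction a with
    | top => exact absurd h (by exact_mod_cast (by simp : ¬ (⊤ : ℕ∞) + 1 ≤ (d : ℕ∞) + 1))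
    | coe a =>
      norm_cast at h ⊢
      lia

/-! ### The induction on the dimension bound. -/

namespace localCohomology

variable (I : Ideal R)

/-- Inductive step: under condition `(C_I)`, membership of `H^(d+1)(M)` follows from that of
`H^d(M ⧸ x M)` for an `M`-regular element `x` of `I`. -/
lemma extensionClass_extLimit_succ_of_isSMulRegular {S₁ S₂ : ObjectProperty (ModuleCat.{u} R)}
    [S₁.IsSerreClass] [S₂.IsSerreClass] (hC : ConditionC I (extensionClass S₁ S₂))
    {M : ModuleCat.{u} R} {x : R} (hxI : x ∈ I) (hx : IsSMulRegular M x) {d : ℕ}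
    (h : extensionClass S₁ S₂ (ModuleCat.of R (ExtLimit I (M.smulShortComplex x).X₃ d))) :
    extensionClass S₁ S₂ (ModuleCat.of R (ExtLimit I M (d + 1))) := by
  refine hC _ ?_ ?_
  · rw [eq_top_iff]
    exact fun z _ => exists_pow_smul_eq_zero I M (d + 1) z
  · have hle : Submodule.torsionBySet R (ExtLimit I M (d + 1)) (I : Set R) ≤
        LinearMap.range
          (extLimitMap I hx.smulShortComplex_shortExact.extClass (rfl : d + 1 = d + 1)) :=
      fun z hz => mem_range_extLimitMap_of_smul_eq_zero I hx d z
        ((Submodule.mem_torsionBySet_iff _ _).1 hz ⟨x, hxI⟩)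
    exact extensionClass_of_injective (Submodule.inclusion_injective hle)
      (extensionClass_of_surjective (M := ExtLimit I (M.smulShortComplex x).X₃ d)
        (f := (extLimitMap I hx.smulShortComplex_shortExact.extClass rfl).rangeRestrict)
        (LinearMap.surjective_rangeRestrict _) h)

/-- Under condition `(C_I)`, the module `H^d(M)` is in `(S₁, S₂)` whenever `dim M ≤ d`. -/
theorem extensionClass_extLimit [IsNoetherianRing R] [IsLocalRing R] {S₁ S₂ : ObjectProperty (ModuleCat.{u} R)}
    [S₁.IsSerreClass] [S₂.IsSerreClass]
    (hk : S₁ (ModuleCat.of R (R ⧸ IsLocalRing.maximalIdeal R)))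
    (hC : ConditionC I (extensionClass S₁ S₂)) (d : ℕ) (M : ModuleCat.{u} R) [Module.Finite R M]
    (hd : Module.supportDim R M ≤ (d : WithBot ℕ∞)) :
    extensionClass S₁ S₂ (ModuleCat.of R (ExtLimit I M d)) := by
  -- With a bound in place of an equality, the induction needs no exact dimension of `N/xN` and
  -- covers zero modules.
  induction d generalizing M with
  | zero =>
    obtain ⟨f, hf⟩ := exists_injective_extLimit_zero I M
    refine extensionClass_of_injective hf (extensionClass_of_left ?_)
    exact prop_of_support_subset hk M
      (asIdeal_eq_maximalIdeal_of_supportDim_le_zero (by simpa using hd))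
  | succ d ih =>
    have hS := LinearMap.shortExact_shortComplexKer (gammaTorsion I M).mkQ_surjective
    obtain ⟨k, hΓ⟩ := exists_pow_smul_gammaTorsion_eq_zero I M
    have hK : ∀ a ∈ I ^ k, ∀ y : LinearMap.ker (gammaTorsion I M).mkQ, a • y = 0 := by
      rintro a ha ⟨y, hy⟩
      have hy' : y ∈ gammaTorsion I M := (Submodule.Quotient.mk_eq_zero _).1 hy
      have h := congrArg Subtype.val (hΓ a ha ⟨y, hy'⟩)
      exact Subtype.ext h
    -- Passes from `M` to `M/Γ_I(M)`, which has no `I`-torsion.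
    refine extensionClass_of_injective (extLimitMap_injective I hS hK d) ?_
    obtain ⟨x, hxI, hx⟩ := exists_isSMulRegular_of_gammaTorsion_eq_bot I _
      (gammaTorsion_quotient_eq_bot I M)
    have hdim : Module.supportDim R (M ⧸ gammaTorsion I M) ≤ ((d + 1 : ℕ) : WithBot ℕ∞) :=
      (Module.supportDim_le_of_surjective _ (gammaTorsion I M).mkQ_surjective).trans hd
    exact extensionClass_extLimit_succ_of_isSMulRegular I hC hxI hx
      (ih (ModuleCat.of R (QuotSMulTop x (M ⧸ gammaTorsion I M))) (supportDim_quotSMulTop_le hx hdim))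

end localCohomology

end

/-- If `M` is nonzero, then `d` is its dimension; the dimension of the zero module is left to
convention, so that every degree `d` is allowed for it. -/
theorem proposition4p4 {R : Type u} [CommRing R] [IsNoetherianRing R] [IsLocalRing R]
    (I : Ideal R) (S₁ S₂ : ObjectProperty (ModuleCat.{u} R))
    (hS₁ : S₁.IsSerreClass) (hS₂ : S₂.IsSerreClass)
    (hne₁ : ∃ N : ModuleCat.{u} R, S₁ N ∧ Nontrivial N)
    (hne₂ : ∃ N : ModuleCat.{u} R, S₂ N ∧ Nontrivial N)
    (hC : ConditionC I (extensionClass S₁ S₂))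
    (M : ModuleCat.{u} R) (hM : Module.Finite R M)
    (d : ℕ) (hd : Subsingleton M ∨ Module.supportDim R M = (d : WithBot ℕ∞)) :
    extensionClass S₁ S₂ ((localCohomology I d).obj M) := by
  obtain ⟨N, hN, hN'⟩ := hne₁
  -- The zero module has dimension `⊥`, so the bound holds for every `d`.
  have hdim : Module.supportDim R M ≤ (d : WithBot ℕ∞) := by
    rcases hd with h | h
    · rw [Module.supportDim_eq_bot_of_subsingleton]
      exact bot_le
    · exact h.le
  exact extensionClass_of_injective (localCohomology.extLimitEquiv I M d).symm.injective
    (localCohomology.extensionClass_extLimit I (prop_residueField N hN) hC d M hdim)
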